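/- Let $I=[a,b]$ with $a\le b$, let $d\in\mathbb N$, let $\Gamma_I=C^0(I;\mathbb R^d)$ with the uniform norm and $\mathrm{ev}_t(\gamma)=\gamma(t)$. For a separable metric space $X$ let $\mathcal P(X)$ be the set of Borel probability measures on $X$ with the topology of narrow convergence (convergence against bounded continuous functions). Let $L: I\times\mathbb R^d\times\mathbb R^d\times\mathcal P(\mathbb R^d)\to[0,+\infty]$ be a Borel function such that $L(t,\cdot,\cdot,\cdot)$ is sequentially lower semicontinuous for a.e. $t\in I$, $L(\cdot,x,z,\mu)$ is Lebesgue measurable for all $(x,z,\mu)$, and $L(t,x,\cdot,\mu)$ is convex for all $(t,x,\mu)$. Let $G:\mathbb R^d\times\mathcal P(\mathbb R^d)\to[0,+\infty]$ be a sequentially lower semicontinuous Borel function, and let $\psi,\phi:[0,1]\to[0,+\infty]$ be lower semicontinuous and non-increasing. For $\eta\in\mathcal P(\Gamma_I)$, $t\in I$, $y\in\mathbb R^d$ let $m_t(y;\eta)=\eta(\{\gamma\in\Gamma_I:\gamma(t)=y\})$ be the multiplicity of $\eta$ at $y$ at time $t$, and define, with the convention $0\cdot\infty=0$, $$\mathcal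 L_\psi(\eta)=\int_{\Gamma_I}\int_I \psi\big(m_t(\gamma(t);\eta)\big)\,L\big(t,\gamma(t),\dot\gamma(t),(\mathrm{ev}_t)_\sharp\eta\big)\,dt\,d\eta(\gamma),$$ $$\mathcal G_\phi(\eta)=\int_{\Gamma_I}\phi\big(m_b(\gamma(b);\eta)\big)\,G\big(\gamma(b),(\mathrm{ev}_b)_\sharp\eta\big)\,d\eta(\gamma),\qquad \mathcal E_{\psi,\phi}=\mathcal L_\psi+\mathcal G_\phi,$$ where $\dot\gamma(t)$ is the derivative of $\gamma$ at $t$ if it exists and $0$ otherwise. Let $q\in[1,+\infty)$, and let $W^{1,q}(I;\mathbb R^d)\subseteq\Gamma_I$ be the space of absolutely continuous curves with derivative in $L^q(I;\mathbb R^d)$, with its norm topology, given by the norm $\max(\|\gamma\|_\infty,\|\dot\gamma\|_{L^q})$ (for $a<b$ equivalent to $\|\gamma\|_{L^q}+\|\dot\gamma\|_{L^q}$). A measure $\eta\in\mathcal P(W^{1,q}(I;\mathbb R^d))$ is regarded as an element of $\mathcal P(\Gamma_I)$ through the inclusion $W^{1,q}(I;\mathbb R^d)\subseteq\Gamma_I$.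 Then $\mathcal E_{\psi,\phi}:\mathcal P(W^{1,q}(I;\mathbb R^d))\to[0,+\infty]$ is sequentially lower semicontinuous with respect to narrow convergence: if $\eta_n\to\eta$ narrowly in $\mathcal P(W^{1,q}(I;\mathbb R^d))$, then $\mathcal E_{\psi,\phi}(\eta)\le\liminf_{n\to\infty}\mathcal E_{\psi,\phi}(\eta_n)$. -/

import Mathlib

open Set Filter Topology MeasureTheory
open scoped ENNReal NNReal unitInterval

noncomputable section

/-- Sequential lower semicontinuity of a `[0, ∞]`-valued function. -/
def SeqLSC {X : Type*} [TopologicalSpace X] (f : X → ℝ≥0∞) : Prop :=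
  ∀ (u : ℕ → X) (x : X), Tendsto u atTop (𝓝 x) →
    f x ≤ liminf (fun n => f (u n)) atTop

/-- Borel functions between topological spaces. -/
def IsBorelFun {X Y : Type*} [TopologicalSpace X] [TopologicalSpace Y] (f : X → Y) : Prop :=
  Measurable[borel X, borel Y] f

/-- `ℝ^d` with the Euclidean norm. -/
abbrev Eucl (d : ℕ) : Type := EuclideanSpace ℝ (Fin d)

/-- The space of continuous curves `Γ_I = C⁰(I; ℝ^d)`, `I = [a, b]`, with the uniform distance. -/
abbrev PathSpace (a b : ℝ) (d : ℕ) : Type := C(Icc a b, Eucl d)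

instance pathMeasurableSpace (a b : ℝ) (d : ℕ) : MeasurableSpace (PathSpace a b d) := borel _

instance pathBorelSpace (a b : ℝ) (d : ℕ) : BorelSpace (PathSpace a b d) := ⟨rfl⟩

/-- The Lebesgue measure on `I = [a, b]`. -/
def leb (a b : ℝ) : Measure (Icc a b) := (volume : Measure ℝ).comap Subtype.val

variable {a b : ℝ} {d : ℕ}

/-- The evaluation map `ev_t` is measurable. -/
theorem measurable_ev (t : Icc a b) : Measurable (fun γ : PathSpace a b d => γ t) :=
  (continuous_eval_const t).measurable

/-- A curve on `I = [a, b]` seen as a function on `ℝ` (with value `0` outside `I`). Only its values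
on `I` are ever used. -/
def onReal (γ : PathSpace a b d) : ℝ → Eucl d :=
  Function.extend Subtype.val γ 0

/-- The derivative `ev̇_t(γ)`: the limit of `(γ(s) - γ(t)) / (s - t)` as `s → t`, `s ∈ I`, if `γ` is
differentiable at `t`, and `0` otherwise. -/
def evDot (t : Icc a b) (γ : PathSpace a b d) : Eucl d :=
  derivWithin (onReal γ) (Icc a b) t

/-- The marginal `(ev_t)_# η` of `η ∈ P(Γ_I)`. -/
def marginal (t : Icc a b) (η : ProbabilityMeasure (PathSpace a b d)) :
    ProbabilityMeasure (Eucl d) :=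
  η.map (measurable_ev t).aemeasurable

/-- The multiplicity `η({γ ∈ Γ_I : γ(t) = y}) ∈ [0, 1]` of `η` at the point `y` at time `t`. -/
def multAt (t : Icc a b) (y : Eucl d) (η : ProbabilityMeasure (PathSpace a b d)) : I :=
  ⟨(η : Measure (PathSpace a b d)).real {γ | γ t = y}, measureReal_nonneg, measureReal_le_one⟩

/-- The hypotheses on a Lagrangian `L : I × ℝ^d × ℝ^d × P(ℝ^d) → [0, ∞]`. -/
structure IsLagrangian (L : Icc a b → Eucl d → Eucl d → ProbabilityMeasure (Eucl d) → ℝ≥0∞) :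
    Prop where
  borel : IsBorelFun
    (fun p : Icc a b × Eucl d × Eucl d × ProbabilityMeasure (Eucl d) =>
      L p.1 p.2.1 p.2.2.1 p.2.2.2)
  lsc : ∀ᵐ t ∂(leb a b), SeqLSC
    (fun p : Eucl d × Eucl d × ProbabilityMeasure (Eucl d) => L t p.1 p.2.1 p.2.2)
  lebesgue : ∀ x z μ, NullMeasurable (fun t : Icc a b => L t x z μ) (leb a b)
  convex : ∀ t x μ, ConvexOn ℝ≥0 univ (fun z => L t x z μ)

/-- The hypotheses on a terminal cost `G : ℝ^d × P(ℝ^d) → [0, ∞]`. -/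
structure IsTerminalCost (G : Eucl d → ProbabilityMeasure (Eucl d) → ℝ≥0∞) : Prop where
  borel : IsBorelFun (fun p : Eucl d × ProbabilityMeasure (Eucl d) => G p.1 p.2)
  lsc : SeqLSC (fun p : Eucl d × ProbabilityMeasure (Eucl d) => G p.1 p.2)

/-- The hypotheses on a weight `[0, 1] → [0, ∞]`: lower semicontinuous and non-increasing. -/
structure IsWeight (ψ : I → ℝ≥0∞) : Prop where
  lsc : LowerSemicontinuous ψ
  anti : Antitone ψ

/-- The functional `L_ψ` on `P(Γ_I)` (products in `[0, ∞]` use `0 · ∞ = 0`). -/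
def runningCost (ψ : I → ℝ≥0∞)
    (L : Icc a b → Eucl d → Eucl d → ProbabilityMeasure (Eucl d) → ℝ≥0∞)
    (η : ProbabilityMeasure (PathSpace a b d)) : ℝ≥0∞ :=
  ∫⁻ γ : PathSpace a b d, (∫⁻ t : Icc a b,
    ψ (multAt t (γ t) η) * L t (γ t) (evDot t γ) (marginal t η) ∂(leb a b)) ∂(η : Measure _)

/-- The functional `G_φ` on `P(Γ_I)`. -/
def terminalCost (hab : a ≤ b) (φ : I → ℝ≥0∞)
    (G : Eucl d → ProbabilityMeasure (Eucl d) → ℝ≥0∞)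
    (η : ProbabilityMeasure (PathSpace a b d)) : ℝ≥0∞ :=
  ∫⁻ γ : PathSpace a b d,
    φ (multAt ⟨b, right_mem_Icc.2 hab⟩ (γ ⟨b, right_mem_Icc.2 hab⟩) η) *
      G (γ ⟨b, right_mem_Icc.2 hab⟩) (marginal ⟨b, right_mem_Icc.2 hab⟩ η) ∂(η : Measure _)

/-- The functional `E_{ψ,φ} = L_ψ + G_φ` on `P(Γ_I)`. -/
def totalCost (hab : a ≤ b) (ψ φ : I → ℝ≥0∞)
    (L : Icc a b → Eucl d → Eucl d → ProbabilityMeasure (Eucl d) → ℝ≥0∞)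
    (G : Eucl d → ProbabilityMeasure (Eucl d) → ℝ≥0∞)
    (η : ProbabilityMeasure (PathSpace a b d)) : ℝ≥0∞ :=
  runningCost ψ L η + terminalCost hab φ G η

/-- The Sobolev space `W^{1,q}(I; ℝ^d)`, `I = [a, b]`: the absolutely continuous curves whose
derivative belongs to `L^q(I; ℝ^d)`. -/
def SobolevPath (a b : ℝ) (d : ℕ) (q : ℝ≥0∞) : Type :=
  {γ : PathSpace a b d //
    AbsolutelyContinuousOnInterval (onReal γ) a b ∧ MemLp (fun t => evDot t γ) q (leb a b)}

namespace SobolevPath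

variable {q : ℝ≥0∞}

/-- The inclusion `W^{1,q}(I; ℝ^d) ⊆ Γ_I`. -/
def toPath (γ : SobolevPath a b d q) : PathSpace a b d := γ.1

/-- The derivative, as an element of `L^q(I; ℝ^d)`. -/
def derivLp (γ : SobolevPath a b d q) : Lp (Eucl d) q (leb a b) :=
  γ.2.2.toLp

/-- The map `γ ↦ (γ, γ̇)` into `Γ_I × L^q(I; ℝ^d)`. -/
def graphMap (γ : SobolevPath a b d q) :
    PathSpace a b d × Lp (Eucl d) q (leb a b) :=
  (γ.toPath, γ.derivLp)

theorem graphMap_injective : Function.Injective (graphMap (a := a) (b := b) (d := d) (q := q)) :=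
  fun _ _ h => Subtype.ext (congrArg Prod.fst h)

/-- The norm distance of `W^{1,q}(I; ℝ^d)`, in the form
`max (‖γ₁ - γ₂‖_∞) (‖γ̇₁ - γ̇₂‖_{L^q})`. For `a < b` this norm is equivalent to
`‖γ‖_{L^q} + ‖γ̇‖_{L^q}`, by the continuity of the inclusion of `W^{1,q}` in `C⁰`; for `a = b` it is
the norm of `ℝ^d`. -/
instance instMetricSpace [Fact (1 ≤ q)] : MetricSpace (SobolevPath a b d q) :=
  MetricSpace.induced graphMap graphMap_injective inferInstance

instance instMeasurableSpace [Fact (1 ≤ q)] : MeasurableSpace (SobolevPath a b d q) := borel _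

instance instBorelSpace [Fact (1 ≤ q)] : BorelSpace (SobolevPath a b d q) := ⟨rfl⟩

theorem measurable_toPath [Fact (1 ≤ q)] :
    Measurable (toPath : SobolevPath a b d q → PathSpace a b d) :=
  (continuous_fst.comp (continuous_induced_dom (f := graphMap))).measurable

/-- The measure on `Γ_I` carried by `W^{1,q}(I; ℝ^d)` that `η ∈ P(W^{1,q}(I; ℝ^d))` defines. -/
def lawOnPaths [Fact (1 ≤ q)] (η : ProbabilityMeasure (SobolevPath a b d q)) :
    ProbabilityMeasure (PathSpace a b d) :=
  η.map measurable_toPath.aemeasurable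

end SobolevPath

end

section LowerSemicontinuity

variable {a b : ℝ} {d : ℕ}

/-! Both costs are integrals over `W^{1,q}` of a cost of the single curve that depends on `η`
itself, so integrand and measure vary together. A Fatou lemma for narrowly converging measures
(`lintegral_le_liminf_lintegral_of_tendsto`) reduces the claim to a joint inequality: if `η_n → η`
narrowly and `γ_n → γ` in `W^{1,q}`, then the cost of `γ` under `η` is at most the liminf of the
costs of `γ_n` under `η_n`.

For the running cost this is `pathCost_le_liminf`. Norm convergence makes the derivatives converge
a.e. along a subsequence, so lower semicontinuity of `L(t, ·)` applies at a.e. time and the usual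
Fatou lemma in `t` concludes. The weight is harmless: masses of points are upper semicontinuous
under narrow convergence, and a non-increasing lower semicontinuous `ψ` turns this into lower
semicontinuity. -/

theorem ENNReal.liminf_add_liminf_le (u v : ℕ → ℝ≥0∞) :
    liminf u atTop + liminf v atTop ≤ liminf (fun n => u n + v n) atTop := by
  simp only [liminf_eq_iSup_iInf_of_nat]
  refine ENNReal.iSup_add_iSup_le fun i j => le_iSup_of_le (max i j) (le_iInf₂ fun n hn => ?_)
  exact add_le_add (iInf₂_le n ((le_max_left i j).trans hn))
    (iInf₂_le n ((le_max_right i j).trans hn))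

/-! ### Fatou's lemma with varying measures and integrands. -/

section VaryingFatou

variable {X : Type*} [PseudoMetricSpace X]

/-- The `k`-Lipschitz envelope of the functions `min (F n) k`, `n ≥ k`. -/
noncomputable def lipEnvelope (F : ℕ → X → ℝ≥0∞) (k : ℕ) (x : X) : ℝ≥0∞ :=
  ⨅ (n : ℕ) (_ : k ≤ n) (y : X), min (F n y) k + k * edist x y

theorem lipEnvelope_le (F : ℕ → X → ℝ≥0∞) {k n : ℕ} (hkn : k ≤ n) (x : X) :
    lipEnvelope F k x ≤ F n x :=
  (iInf₂_le n hkn).trans <| (iInf_le _ x).trans <| by simp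

theorem lipEnvelope_le_natCast (F : ℕ → X → ℝ≥0∞) (k : ℕ) (x : X) :
    lipEnvelope F k x ≤ k :=
  (iInf₂_le k le_rfl).trans <| (iInf_le _ x).trans <| by simp

theorem lipEnvelope_mono (F : ℕ → X → ℝ≥0∞) : Monotone (lipEnvelope F) := by
  intro k l hkl x
  refine le_iInf₂ fun n hn => le_iInf fun y => ?_
  refine (iInf₂_le n (hkl.trans hn)).trans <| (iInf_le _ y).trans ?_
  have : (k : ℝ≥0∞) ≤ l := by exact_mod_cast hkl
  gcongr

theorem continuous_lipEnvelope (F : ℕ → X → ℝ≥0∞) (k : ℕ) : Continuous (lipEnvelope F k) := by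
  refine continuous_of_le_add_edist k (by simp) fun x y => ?_
  simp only [lipEnvelope, ENNReal.iInf_add]
  refine le_iInf₂ fun n hn => le_iInf fun z => ?_
  refine (iInf₂_le n hn).trans <| (iInf_le _ z).trans ?_
  rw [add_assoc, ← mul_add]
  gcongr
  rw [add_comm]
  exact edist_triangle x y z

/-- If all envelopes at `x` stay below some `r < c`, near-minimisers `u k` with indices `N k ≥ k`
exist. The penalty `k * edist x (u k) < r` forces `u k → x`, while `F (N k) (u k)` stays below `r`,
against the hypothesis. -/
theorem le_iSup_lipEnvelope {F : ℕ → X → ℝ≥0∞} {c : ℝ≥0∞} {x : X}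
    (h : ∀ (u : ℕ → X) (N : ℕ → ℕ), Tendsto u atTop (𝓝 x) → Tendsto N atTop atTop →
      c ≤ liminf (fun k => F (N k) (u k)) atTop) :
    c ≤ ⨆ k, lipEnvelope F k x := by
  by_contra! hlt
  obtain ⟨r, hr, hrc⟩ := exists_between hlt
  have hr_top : r ≠ ∞ := hrc.ne_top
  have hex : ∀ k : ℕ, ∃ n, k ≤ n ∧ ∃ y, min (F n y) k + k * edist x y < r := by
    intro k
    have := (le_iSup (fun k => lipEnvelope F k x) k).trans_lt hr
    simpa [lipEnvelope, iInf_lt_iff] using this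
  choose N hN u hu using hex
  have hNt : Tendsto N atTop atTop := tendsto_atTop_mono hN tendsto_id
  have hut : Tendsto u atTop (𝓝 x) := by
    rw [tendsto_iff_edist_tendsto_0]
    have hlim : Tendsto (fun k : ℕ => r / k) atTop (𝓝 0) :=
      by simpa using ENNReal.Tendsto.const_div (a := r) ENNReal.tendsto_nat_nhds_top (Or.inr hr_top)
    refine tendsto_of_tendsto_of_tendsto_of_le_of_le' tendsto_const_nhds hlim
      (Eventually.of_forall fun _ => zero_le) ?_
    filter_upwards [eventually_gt_atTop 0] with k hk
    rw [ENNReal.le_div_iff_mul_le (by simp [hk.ne']) (by simp), mul_comm, edist_comm]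
    exact le_add_self.trans (hu k).le
  -- Once `k > r`, the truncation at `k` cannot be what keeps the minimum below `r`.
  obtain ⟨m, hm⟩ := ENNReal.exists_nat_gt hr_top
  refine absurd (h u N hut hNt) (not_le.2 (lt_of_le_of_lt ?_ hrc))
  refine liminf_le_of_frequently_le' (Eventually.frequently ?_)
  filter_upwards [eventually_ge_atTop m] with k hk
  have hk' : r < k := hm.trans_le (by exact_mod_cast hk)
  have := le_self_add.trans_lt (hu k)
  rcases min_lt_iff.1 this with h1 | h1
  · exact h1.le
  · exact absurd h1 hk'.not_gt

variable [MeasurableSpace X] [OpensMeasurableSpace X]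

/-- The envelope is continuous and bounded by `k`, hence an admissible test function for narrow
convergence. -/
theorem tendsto_lintegral_lipEnvelope {ηs : ℕ → ProbabilityMeasure X} {η : ProbabilityMeasure X}
    (hη : Tendsto ηs atTop (𝓝 η)) (F : ℕ → X → ℝ≥0∞) (k : ℕ) :
    Tendsto (fun n => ∫⁻ x, lipEnvelope F k x ∂(ηs n : Measure X)) atTop
      (𝓝 (∫⁻ x, lipEnvelope F k x ∂(η : Measure X))) := by
  have hne : ∀ x, lipEnvelope F k x ≠ ∞ := fun x =>
    ((lipEnvelope_le_natCast F k x).trans_lt (by simp)).ne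
  have hcont : Continuous fun x => (lipEnvelope F k x).toNNReal :=
    ENNReal.continuousOn_toNNReal.comp_continuous (continuous_lipEnvelope F k) hne
  have hle : ∀ x, (lipEnvelope F k x).toNNReal ≤ k := fun x => by
    simpa using ENNReal.toNNReal_mono (by simp) (lipEnvelope_le_natCast F k x)
  let g : BoundedContinuousFunction X ℝ≥0 :=
    BoundedContinuousFunction.mkOfBound ⟨_, hcont⟩ k fun x y => by
      have hx : ((lipEnvelope F k x).toNNReal : ℝ) ≤ k := by exact_mod_cast hle x
      have hy : ((lipEnvelope F k y).toNNReal : ℝ) ≤ k := by exact_mod_cast hle y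
      rw [NNReal.dist_eq]
      exact abs_sub_le_of_nonneg_of_le (by positivity) hx (by positivity) hy
  have := ProbabilityMeasure.tendsto_iff_forall_lintegral_tendsto.1 hη g
  have hg : ∀ x, (g x : ℝ≥0∞) = lipEnvelope F k x := fun x => ENNReal.coe_toNNReal (hne x)
  simpa only [hg] using this

/-- Fatou's lemma for narrowly converging measures. The functions need not be measurable. -/
theorem lintegral_le_liminf_lintegral_of_tendsto {ηs : ℕ → ProbabilityMeasure X}
    {η : ProbabilityMeasure X} (hη : Tendsto ηs atTop (𝓝 η)) {F : ℕ → X → ℝ≥0∞} {f : X → ℝ≥0∞}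
    (h : ∀ (x : X) (u : ℕ → X) (N : ℕ → ℕ), Tendsto u atTop (𝓝 x) → Tendsto N atTop atTop →
      f x ≤ liminf (fun k => F (N k) (u k)) atTop) :
    ∫⁻ x, f x ∂(η : Measure X) ≤ liminf (fun n => ∫⁻ x, F n x ∂(ηs n : Measure X)) atTop := by
  calc ∫⁻ x, f x ∂(η : Measure X)
      ≤ ∫⁻ x, ⨆ k, lipEnvelope F k x ∂(η : Measure X) :=
        lintegral_mono fun x => le_iSup_lipEnvelope (h x)
    _ = ⨆ k, ∫⁻ x, lipEnvelope F k x ∂(η : Measure X) :=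
        lintegral_iSup (fun k => (continuous_lipEnvelope F k).measurable) (lipEnvelope_mono F)
    _ ≤ _ := iSup_le fun k => by
        -- With `k` fixed, the envelope is a single test function lying below every `F n` with `n ≥
        -- k`.
        rw [← (tendsto_lintegral_lipEnvelope hη F k).liminf_eq]
        refine liminf_le_liminf ?_
        filter_upwards [eventually_ge_atTop k] with n hn
        exact lintegral_mono fun x => lipEnvelope_le F hn x

end VaryingFatou

/-! ### Semicontinuity of multiplicities and weights. -/

section Multiplicity

/-- Upper semicontinuity of the mass of points under narrow convergence. -/
theorem limsup_measure_singleton_le {X : Type*} [MetricSpace X] [MeasurableSpace X]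
    [BorelSpace X] {μs : ℕ → ProbabilityMeasure X} {μ : ProbabilityMeasure X}
    (hμ : Tendsto μs atTop (𝓝 μ)) {u : ℕ → X} {x : X} (hu : Tendsto u atTop (𝓝 x)) :
    limsup (fun n => (μs n : Measure X) {u n}) atTop ≤ (μ : Measure X) {x} := by
  -- Closed balls around `x` eventually contain `u n`, obey the portmanteau bound for closed sets,
  -- and have mass decreasing to that of `{x}`.
  have hlim : Tendsto (fun r : ℝ => (μ : Measure X) (Metric.cthickening r {x})) (𝓝[>] 0)
      (𝓝 ((μ : Measure X) {x})) :=
    (tendsto_measure_cthickening_of_isClosed ⟨1, one_pos, measure_ne_top _ _⟩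
      isClosed_singleton).mono_left nhdsWithin_le_nhds
  refine ge_of_tendsto hlim ?_
  filter_upwards [self_mem_nhdsWithin] with r (hr : 0 < r)
  refine le_trans ?_ (ProbabilityMeasure.limsup_measure_closed_le_of_tendsto hμ
    (Metric.isClosed_cthickening (δ := r) (E := {x})))
  refine limsup_le_limsup ?_
  filter_upwards [Metric.tendsto_nhds.1 hu r hr] with n hn
  refine measure_mono (singleton_subset_iff.2 ?_)
  exact Metric.mem_cthickening_of_dist_le (u n) x r {x} rfl hn.le

theorem tendsto_marginal {ηs : ℕ → ProbabilityMeasure (PathSpace a b d)}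
    {η : ProbabilityMeasure (PathSpace a b d)} (hη : Tendsto ηs atTop (𝓝 η)) (t : Icc a b) :
    Tendsto (fun n => marginal t (ηs n)) atTop (𝓝 (marginal t η)) :=
  ProbabilityMeasure.tendsto_map_of_tendsto_of_continuous _ _ hη (continuous_eval_const t)

/-- Dominated convergence along the continuous curves `t ↦ γ t`. -/
theorem continuous_marginal (η : ProbabilityMeasure (PathSpace a b d)) :
    Continuous fun t : Icc a b => marginal t η := by
  rw [ProbabilityMeasure.continuous_iff_forall_continuous_integral]
  intro f
  have h : ∀ t : Icc a b, ∫ x, f x ∂(marginal t η : Measure (Eucl d)) =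
      ∫ γ : PathSpace a b d, f (γ t) ∂(η : Measure (PathSpace a b d)) := fun t =>
    integral_map (measurable_ev t).aemeasurable f.continuous.aestronglyMeasurable
  simp only [h]
  refine continuous_of_dominated (bound := fun _ => ‖f‖) (fun t => ?_) (fun t => ?_) ?_ ?_
  · exact (f.continuous.comp (continuous_eval_const t)).aestronglyMeasurable
  · exact Eventually.of_forall fun γ => f.norm_coe_le_norm _
  · exact integrable_const _
  · exact Eventually.of_forall fun γ => f.continuous.comp γ.continuous

/-- Reduces multiplicities to atoms of the marginals, which converge narrowly. -/
theorem coe_multAt (t : Icc a b) (y : Eucl d) (η : ProbabilityMeasure (PathSpace a b d)) :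
    (multAt t y η : ℝ) = ((marginal t η : Measure (Eucl d)) {y}).toReal := by
  have : (marginal t η : Measure (Eucl d)) {y} =
      (η : Measure (PathSpace a b d)) {γ | γ t = y} := by
    rw [marginal, ProbabilityMeasure.toMeasure_map,
      Measure.map_apply (measurable_ev t) (measurableSet_singleton y)]
    rfl
  rw [this]
  rfl

/-- The hypothesis says `limsup m n ≤ m₀`. Lower semicontinuity keeps `ψ` large slightly to the
right of `m₀`, and monotonicity carries the bound to all smaller arguments. -/
theorem IsWeight.le_liminf {ψ : I → ℝ≥0∞} (hψ : IsWeight ψ) {m : ℕ → I} {m₀ : I}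
    (hm : ∀ s : I, m₀ < s → ∀ᶠ n in atTop, m n < s) :
    ψ m₀ ≤ liminf (fun n => ψ (m n)) atTop := by
  refine le_of_forall_lt fun c hc => ?_
  obtain ⟨c', hcc', hc'⟩ := exists_between hc
  refine hcc'.trans_le (le_liminf_of_le (by isBoundedDefault) ?_)
  have hev := hψ.lsc m₀ c' hc'
  -- There is no room to the right of `⊤`, but there `ψ` attains its minimum.
  by_cases htop : m₀ = ⊤
  · refine Eventually.of_forall fun n => hc'.le.trans (hψ.anti ?_)
    exact htop ▸ le_top
  · obtain ⟨s, hs, hsub⟩ := exists_Ico_subset_of_mem_nhds hev ⟨⊤, lt_top_iff_ne_top.2 htop⟩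
    obtain ⟨s', h1, h2⟩ := exists_between hs
    filter_upwards [hm s' h1] with n hn
    exact (hsub ⟨h1.le, h2⟩ : c' < ψ s').le.trans (hψ.anti hn.le)

theorem IsWeight.le_liminf_multAt {ψ : I → ℝ≥0∞} (hψ : IsWeight ψ)
    {ηs : ℕ → ProbabilityMeasure (PathSpace a b d)} {η : ProbabilityMeasure (PathSpace a b d)}
    (hη : Tendsto ηs atTop (𝓝 η)) (t : Icc a b) {u : ℕ → Eucl d} {x : Eucl d}
    (hu : Tendsto u atTop (𝓝 x)) :
    ψ (multAt t x η) ≤ liminf (fun n => ψ (multAt t (u n) (ηs n))) atTop := by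
  refine hψ.le_liminf fun s hs => ?_
  have hs' : (multAt t x η : ℝ) < s := hs
  rw [coe_multAt, ← ENNReal.lt_ofReal_iff_toReal_lt (measure_ne_top _ _)] at hs'
  have := eventually_lt_of_limsup_lt
    ((limsup_measure_singleton_le (tendsto_marginal hη t) hu).trans_lt hs')
  filter_upwards [this] with n hn
  rw [ENNReal.lt_ofReal_iff_toReal_lt (measure_ne_top _ _), ← coe_multAt] at hn
  exact hn

end Multiplicity

/-! ### Joint measurability of the integrands in curve and time. -/

section Measurability

theorem leb_apply {s : Set (Icc a b)} (hs : MeasurableSet s) :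
    leb a b s = volume (Subtype.val '' s) :=
  Measure.comap_apply _ Subtype.val_injective
    (fun _ h => (MeasurableEmbedding.subtype_coe measurableSet_Icc).measurableSet_image.2 h) _ hs

instance isFiniteMeasure_leb : IsFiniteMeasure (leb a b) := by
  refine ⟨?_⟩
  rw [leb_apply MeasurableSet.univ]
  exact (measure_mono (by rintro _ ⟨t, -, rfl⟩; exact t.2)).trans_lt (measure_Icc_lt_top (a := a) (b := b))

theorem ae_leb_mem_Ioo : ∀ᵐ t : Icc a b ∂(leb a b), (t : ℝ) ∈ Ioo a b := by
  have h : ∀ c : ℝ, ∀ᵐ t : Icc a b ∂(leb a b), (t : ℝ) ≠ c := fun c => by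
    have hm : MeasurableSet {t : Icc a b | (t : ℝ) = c} :=
      measurable_subtype_coe (measurableSet_singleton c)
    rw [ae_iff]
    simp only [ne_eq, not_not]
    rw [leb_apply hm]
    refine measure_mono_null (t := {c}) ?_ Real.volume_singleton
    rintro _ ⟨t, ht, rfl⟩
    exact ht
  filter_upwards [h a, h b] with t hta htb
  exact ⟨lt_of_le_of_ne t.2.1 hta.symm, lt_of_le_of_ne t.2.2 htb⟩

/-- Extending `γ` by constants beyond the endpoints gives a continuous function on `ℝ`, so the joint
measurability of derivatives depending on a parameter becomes available; the endpoints are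
negligible by `ae_leb_mem_Ioo`. -/
theorem evDot_eq_deriv (hab : a ≤ b) {t : Icc a b} (ht : (t : ℝ) ∈ Ioo a b)
    (γ : PathSpace a b d) : evDot t γ = deriv (fun s => γ (projIcc a b hab s)) t := by
  have h : EqOn (onReal γ) (fun s => γ (projIcc a b hab s)) (Icc a b) := by
    intro s hs
    have h1 : onReal γ s = γ ⟨s, hs⟩ := Subtype.val_injective.extend_apply γ 0 (⟨s, hs⟩ : Icc a b)
    simp only [h1, projIcc_of_mem hab hs]
  rw [evDot, derivWithin_congr h (h t.2), derivWithin_of_mem_nhds (Icc_mem_nhds ht.1 ht.2)]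

theorem measurable_deriv_projIcc (hab : a ≤ b) :
    Measurable fun p : PathSpace a b d × Icc a b =>
      deriv (fun s => p.1 (projIcc a b hab s)) (p.2 : ℝ) := by
  have hc : Continuous (Function.uncurry fun (γ : PathSpace a b d) (s : ℝ) =>
      γ (projIcc a b hab s)) := by
    have : Continuous (projIcc a b hab) := continuous_projIcc
    simp only [Function.uncurry_def]
    fun_prop
  exact (measurable_deriv_with_param hc).comp
    (measurable_fst.prodMk (measurable_subtype_coe.comp measurable_snd))

theorem measurable_pathEval :
    Measurable fun p : PathSpace a b d × Icc a b => p.1 p.2 :=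
  (by fun_prop : Continuous fun p : PathSpace a b d × Icc a b => p.1 p.2).measurable

theorem IsWeight.measurable_multAt {ψ : I → ℝ≥0∞} (hψ : IsWeight ψ)
    (η : ProbabilityMeasure (PathSpace a b d)) :
    Measurable fun p : PathSpace a b d × Icc a b => ψ (multAt p.2 (p.1 p.2) η) := by
  refine hψ.anti.measurable.comp (Measurable.subtype_mk ?_)
  -- The multiplicity along `(γ, t)` is the mass of a section of the closed set of triples `((γ, t),
  -- σ)` with `σ t = γ t`.
  have hcl : IsClosed {r : (PathSpace a b d × Icc a b) × PathSpace a b d |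
      r.2 r.1.2 = r.1.1 r.1.2} := isClosed_eq (by fun_prop) (by fun_prop)
  exact (measurable_measure_prodMk_left (ν := (η : Measure (PathSpace a b d)))
    hcl.measurableSet).ennreal_toReal

/-- The Borel σ-algebra of a product may exceed the product σ-algebra, so the inner map is taken
continuous; this is why `continuous_marginal` is needed. -/
theorem IsBorelFun.measurable_comp {X Y Z : Type*} [TopologicalSpace X] [TopologicalSpace Y]
    [TopologicalSpace Z] [MeasurableSpace X] [OpensMeasurableSpace X] [MeasurableSpace Z]
    [BorelSpace Z] {f : Y → Z} (hf : IsBorelFun f) {g : X → Y} (hg : Continuous g) :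
    Measurable fun x => f (g x) := by
  borelize Y
  have h : Measurable f := by
    rw [BorelSpace.measurable_eq (α := Z)]
    exact hf
  exact h.comp hg.measurable

variable {L : Icc a b → Eucl d → Eucl d → ProbabilityMeasure (Eucl d) → ℝ≥0∞}

theorem IsLagrangian.measurable_marginal (hL : IsLagrangian L)
    (η : ProbabilityMeasure (PathSpace a b d)) :
    Measurable fun p : Icc a b × Eucl d × Eucl d => L p.1 p.2.1 p.2.2 (marginal p.1 η) :=
  hL.borel.measurable_comp (g := fun p : Icc a b × Eucl d × Eucl d =>
    (p.1, p.2.1, p.2.2, marginal p.1 η)) <|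
    continuous_fst.prodMk <| continuous_snd.fst.prodMk <| continuous_snd.snd.prodMk <|
      (continuous_marginal η).comp continuous_fst

/-- The integrand of the running cost, with the derivative in jointly measurable form. -/
noncomputable def runningIntegrand (hab : a ≤ b) (ψ : I → ℝ≥0∞)
    (L : Icc a b → Eucl d → Eucl d → ProbabilityMeasure (Eucl d) → ℝ≥0∞)
    (η : ProbabilityMeasure (PathSpace a b d)) (p : PathSpace a b d × Icc a b) : ℝ≥0∞ :=
  ψ (multAt p.2 (p.1 p.2) η) *
    L p.2 (p.1 p.2) (deriv (fun s => p.1 (projIcc a b hab s)) (p.2 : ℝ)) (marginal p.2 η)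

theorem measurable_runningIntegrand (hab : a ≤ b) {ψ : I → ℝ≥0∞} (hψ : IsWeight ψ)
    (hL : IsLagrangian L) (η : ProbabilityMeasure (PathSpace a b d)) :
    Measurable (runningIntegrand hab ψ L η) :=
  (hψ.measurable_multAt η).mul <| (hL.measurable_marginal η).comp <|
    measurable_snd.prodMk <| measurable_pathEval.prodMk <| measurable_deriv_projIcc hab

/-- The running cost of a single path in the field of marginals and multiplicities of `η`. -/
noncomputable def pathCost (hab : a ≤ b) (ψ : I → ℝ≥0∞)
    (L : Icc a b → Eucl d → Eucl d → ProbabilityMeasure (Eucl d) → ℝ≥0∞)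
    (η : ProbabilityMeasure (PathSpace a b d)) (γ : PathSpace a b d) : ℝ≥0∞ :=
  ∫⁻ t, runningIntegrand hab ψ L η (γ, t) ∂(leb a b)

theorem measurable_pathCost (hab : a ≤ b) {ψ : I → ℝ≥0∞} (hψ : IsWeight ψ)
    (hL : IsLagrangian L) (η : ProbabilityMeasure (PathSpace a b d)) :
    Measurable (pathCost hab ψ L η) :=
  (measurable_runningIntegrand hab hψ hL η).lintegral_prod_right'

theorem runningCost_eq_lintegral_pathCost (hab : a ≤ b) (ψ : I → ℝ≥0∞)
    (L : Icc a b → Eucl d → Eucl d → ProbabilityMeasure (Eucl d) → ℝ≥0∞)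
    (η : ProbabilityMeasure (PathSpace a b d)) :
    runningCost ψ L η = ∫⁻ γ, pathCost hab ψ L η γ ∂(η : Measure (PathSpace a b d)) := by
  refine lintegral_congr fun γ => lintegral_congr_ae ?_
  filter_upwards [ae_leb_mem_Ioo] with t ht
  simp only [runningIntegrand, evDot_eq_deriv hab ht γ]

end Measurability

/-! ### Semicontinuity along Sobolev curves. -/

namespace SobolevPath

variable {q : ℝ≥0∞} [Fact (1 ≤ q)]

theorem continuous_graphMap :
    Continuous (graphMap : SobolevPath a b d q → PathSpace a b d × Lp (Eucl d) q (leb a b)) :=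
  continuous_induced_dom

theorem continuous_toPath : Continuous (toPath : SobolevPath a b d q → PathSpace a b d) :=
  continuous_fst.comp continuous_graphMap

/-- Along a subsequence, the derivatives of a convergent sequence of Sobolev curves converge
almost everywhere. -/
theorem exists_subseq_tendsto_evDot {u : ℕ → SobolevPath a b d q} {γ : SobolevPath a b d q}
    (hu : Tendsto u atTop (𝓝 γ)) :
    ∃ s : ℕ → ℕ, StrictMono s ∧ ∀ᵐ t ∂(leb a b),
      Tendsto (fun k => evDot t (u (s k)).toPath) atTop (𝓝 (evDot t γ.toPath)) := by
  have hlim : Tendsto (fun n => (u n).derivLp) atTop (𝓝 γ.derivLp) :=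
    ((continuous_snd.comp continuous_graphMap).tendsto γ).comp hu
  obtain ⟨s, hs, hae⟩ := (tendstoInMeasure_of_tendsto_Lp hlim).exists_seq_tendsto_ae
  refine ⟨s, hs, ?_⟩
  have h1 : ∀ᵐ t ∂(leb a b), ∀ k, (u k).derivLp t = evDot t (u k).toPath :=
    ae_all_iff.2 fun k => (u k).2.2.coeFn_toLp
  have h2 : ∀ᵐ t ∂(leb a b), γ.derivLp t = evDot t γ.toPath := γ.2.2.coeFn_toLp
  filter_upwards [hae, h1, h2] with t ht h1 h2
  simpa only [h1, h2] using ht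

theorem pathCost_le_liminf (hab : a ≤ b) {ψ : I → ℝ≥0∞} (hψ : IsWeight ψ)
    {L : Icc a b → Eucl d → Eucl d → ProbabilityMeasure (Eucl d) → ℝ≥0∞} (hL : IsLagrangian L)
    {ηs : ℕ → ProbabilityMeasure (PathSpace a b d)} {η : ProbabilityMeasure (PathSpace a b d)}
    (hη : Tendsto ηs atTop (𝓝 η)) {u : ℕ → SobolevPath a b d q} {γ : SobolevPath a b d q}
    (hu : Tendsto u atTop (𝓝 γ)) :
    pathCost hab ψ L η γ.toPath ≤ liminf (fun n => pathCost hab ψ L (ηs n) (u n).toPath) atTop := by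
  refine le_of_forall_gt fun c hc => ?_
  obtain ⟨c', hc', hcc'⟩ := exists_between hc
  refine lt_of_le_of_lt ?_ hcc'
  -- The subsequence for a.e. convergence of derivatives must be extracted from one along which the
  -- costs already stay below `c'`; otherwise it could miss the liminf.
  obtain ⟨r, hr, hrc⟩ := extraction_of_frequently_atTop (frequently_lt_of_liminf_lt
    (by isBoundedDefault) hc')
  obtain ⟨s, hs, hae⟩ := exists_subseq_tendsto_evDot (hu.comp hr.tendsto_atTop)
  have hrs : Tendsto (fun k => r (s k)) atTop atTop := hr.tendsto_atTop.comp hs.tendsto_atTop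
  have hpt : ∀ᵐ t ∂(leb a b), runningIntegrand hab ψ L η (γ.toPath, t) ≤
      liminf (fun k => runningIntegrand hab ψ L (ηs (r (s k))) ((u (r (s k))).toPath, t))
        atTop := by
    filter_upwards [hae, hL.lsc, ae_leb_mem_Ioo] with t ht hLt htI
    simp only [evDot_eq_deriv hab htI, Function.comp_apply] at ht
    have hpath : Tendsto (fun k => (u (r (s k))).toPath t) atTop (𝓝 (γ.toPath t)) :=
      (((continuous_eval_const t).comp continuous_toPath).tendsto γ).comp (hu.comp hrs)
    refine le_trans ?_ ENNReal.le_liminf_mul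
    refine mul_le_mul' (hψ.le_liminf_multAt (hη.comp hrs) t hpath) ?_
    exact hLt (fun k => (_, _, _)) (_, _, _)
      (hpath.prodMk_nhds (ht.prodMk_nhds (tendsto_marginal (hη.comp hrs) t)))
  calc pathCost hab ψ L η γ.toPath
      ≤ ∫⁻ t, liminf (fun k =>
          runningIntegrand hab ψ L (ηs (r (s k))) ((u (r (s k))).toPath, t)) atTop ∂(leb a b) :=
        lintegral_mono_ae hpt
    _ ≤ liminf (fun k => pathCost hab ψ L (ηs (r (s k))) (u (r (s k))).toPath) atTop :=
        lintegral_liminf_le fun k =>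
          (measurable_runningIntegrand hab hψ hL _).comp measurable_prodMk_left
    _ ≤ c' := liminf_le_of_frequently_le'
        (Frequently.of_forall fun k => (hrc (s k)).le)

theorem tendsto_lawOnPaths {ηs : ℕ → ProbabilityMeasure (SobolevPath a b d q)}
    {η : ProbabilityMeasure (SobolevPath a b d q)} (hη : Tendsto ηs atTop (𝓝 η)) :
    Tendsto (fun n => lawOnPaths (ηs n)) atTop (𝓝 (lawOnPaths η)) :=
  ProbabilityMeasure.tendsto_map_of_tendsto_of_continuous _ _ hη continuous_toPath

theorem seqLSC_runningCost (hab : a ≤ b) {ψ : I → ℝ≥0∞} (hψ : IsWeight ψ)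
    {L : Icc a b → Eucl d → Eucl d → ProbabilityMeasure (Eucl d) → ℝ≥0∞} (hL : IsLagrangian L) :
    SeqLSC (fun η : ProbabilityMeasure (SobolevPath a b d q) =>
      runningCost ψ L (lawOnPaths η)) := by
  intro ηs η hη
  -- The integral is pulled back to `W^{1,q}`, whose finer topology controls derivatives; uniform
  -- convergence of curves would not.
  have h : ∀ η : ProbabilityMeasure (SobolevPath a b d q), runningCost ψ L (lawOnPaths η) =
      ∫⁻ γ, pathCost hab ψ L (lawOnPaths η) γ.toPath ∂(η : Measure (SobolevPath a b d q)) :=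
    fun η => (runningCost_eq_lintegral_pathCost hab ψ L _).trans
      (lintegral_map (measurable_pathCost hab hψ hL _) measurable_toPath)
  simp only [h]
  exact lintegral_le_liminf_lintegral_of_tendsto hη fun γ u N hu hN =>
    pathCost_le_liminf hab hψ hL ((tendsto_lawOnPaths hη).comp hN) hu

theorem seqLSC_terminalCost (hab : a ≤ b) {φ : I → ℝ≥0∞} (hφ : IsWeight φ)
    {G : Eucl d → ProbabilityMeasure (Eucl d) → ℝ≥0∞} (hG : IsTerminalCost G) :
    SeqLSC (fun η : ProbabilityMeasure (SobolevPath a b d q) =>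
      terminalCost hab φ G (lawOnPaths η)) := by
  intro ηs η hη
  set T : Icc a b := ⟨b, right_mem_Icc.2 hab⟩
  have hmeas : ∀ η : ProbabilityMeasure (PathSpace a b d), Measurable fun γ : PathSpace a b d =>
      φ (multAt T (γ T) η) * G (γ T) (marginal T η) := fun η =>
    ((hφ.measurable_multAt η).comp measurable_prodMk_right).mul <|
      hG.borel.measurable_comp (g := fun γ : PathSpace a b d => (γ T, marginal T η))
        ((continuous_eval_const T).prodMk continuous_const)
  have h : ∀ η : ProbabilityMeasure (SobolevPath a b d q), terminalCost hab φ G (lawOnPaths η) =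
      ∫⁻ γ, φ (multAt T (γ.toPath T) (lawOnPaths η)) *
        G (γ.toPath T) (marginal T (lawOnPaths η)) ∂(η : Measure (SobolevPath a b d q)) :=
    fun η => lintegral_map (hmeas _) measurable_toPath
  simp only [h]
  -- The endpoint `γ b` and the law at time `b` converge under uniform convergence, so no
  -- subsequence is needed here.
  refine lintegral_le_liminf_lintegral_of_tendsto hη fun γ u N hu hN => ?_
  have hpath : Tendsto (fun k => (u k).toPath T) atTop (𝓝 (γ.toPath T)) :=
    (((continuous_eval_const T).comp continuous_toPath).tendsto γ).comp hu
  have hlaw := (tendsto_lawOnPaths hη).comp hN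
  refine le_trans ?_ ENNReal.le_liminf_mul
  refine mul_le_mul' (hφ.le_liminf_multAt hlaw T hpath) ?_
  exact hG.lsc (fun k => (_, _)) (_, _) (hpath.prodMk_nhds (tendsto_marginal hlaw T))

end SobolevPath

end LowerSemicontinuity

theorem mainTheorem4 (a b : ℝ) (hab : a ≤ b) (d : ℕ) (q : ℝ≥0∞) [Fact (1 ≤ q)] (hq : q ≠ ∞)
    (L : Icc a b → Eucl d → Eucl d → ProbabilityMeasure (Eucl d) → ℝ≥0∞) (hL : IsLagrangian L)
    (G : Eucl d → ProbabilityMeasure (Eucl d) → ℝ≥0∞) (hG : IsTerminalCost G)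
    (ψ φ : I → ℝ≥0∞) (hψ : IsWeight ψ) (hφ : IsWeight φ) :
    SeqLSC (fun η : ProbabilityMeasure (SobolevPath a b d q) =>
      totalCost hab ψ φ L G (SobolevPath.lawOnPaths η)) := by
  intro ηs η hη
  exact (add_le_add (SobolevPath.seqLSC_runningCost hab hψ hL ηs η hη)
    (SobolevPath.seqLSC_terminalCost hab hφ hG ηs η hη)).trans
    (ENNReal.liminf_add_liminf_le _ _)
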